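/- Let $n\ge 1$. The zigzag snake graph $\mathcal G^z_{n-1}$ consists of $n-1$ unit squares (tiles) of the integer grid, with lower left corners $(0,0),(0,1),(1,1),(1,2),(2,2),\dots$ (the tiles go up, right, up, right, …); $\mathcal G^z_0$ is the single edge from $(0,0)$ to $(1,0)$. Its standard vertex labeling with values in $\{1,\dots,n\}$ gives the label $2j+1$ to both endpoints of the horizontal edge from $(j,j)$ to $(j+1,j)$, and the label $2j+2$ to both endpoints of the vertical edge from $(j,j+1)$ to $(j,j+2)$, except that the largest label $n$ is carried by the last two vertices (the endpoints of the top edge of the last tile if $n-1$ is odd, of its right edge if $n-1$ is even and positive). Let $\Omega(\mathcal G^z_{n-1})$ be the set of mixed dimer covers: functions $\omega$ from the edges to $\mathbb N$ such that for each vertex $v$ the multiplicities $\omega(e)$ of the edges $e$ at $v$ add up to the label of $v$. Color a vertex $(x,y)$ black if $x+y$ is odd and white otherwise. A positive face twist at a tile decreases by $1$ the multiplicities of the two edges of the tile that go from white to black in counter-clockwise direction (these must be positive), and increases by $1$ those of the other two edges of the tile. Order $\Omega(\mathcal G^z_{n-1})$ by the face twist order, the partial order generated by the positive face twists. For $1\le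 i\le n-1$ let $\ell_i(\omega)$ be the multiplicity in $\omega$ of the final edge of the subgraph $\mathcal G^z_{n-i}$ formed by the first $n-i$ tiles, that is, of the right edge of tile number $n-i$ if $n-i$ is odd, and of its top edge if $n-i$ is even. Let $\mathrm{Cat}_n\subseteq S_n$ be the set of $132$-avoiding permutations, let $L(\sigma)=(L_1,\dots,L_n)$, $L_i=\#\{j>i : \sigma(j)<\sigma(i)\}$, be the Lehmer code of $\sigma\in S_n$, and let $\mathrm{inv}(\sigma)$ be its number of inversions. (a) There is a bijection $\varphi\colon\Omega(\mathcal G^z_{n-1})\to\mathrm{Cat}_n$ such that $L(\varphi(\omega))=(\ell_1(\omega),\dots,\ell_{n-1}(\omega),0)$ for all $\omega$, and $\varphi$ is a poset isomorphism from the face twist order onto $\mathrm{Cat}_n$ with the (restricted) Bruhat order. Moreover, for $1\le i\le n-1$, $\omega'$ is obtained from $\omega$ by a positive face twist at tile number $n-i$ if and only if $L(\varphi(\omega'))$ is obtained from $L(\varphi(\omega))$ by increasing the $i$-th entry by $1$ and leaving the others unchanged. (b) The face twist order on $\Omega(\mathcal G^z_{n-1})$ has a least element, and if $\mathrm{rk}(\omega)$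 is the minimal number of positive face twists that lead from it to $\omega$, then the rank generating function is the Carlitz–Riordan $q$-Catalan number: $$\sum_{\omega\in\Omega(\mathcal G^z_{n-1})}q^{\mathrm{rk}(\omega)}=C_n(q):=\sum_{\sigma\in\mathrm{Cat}_n}q^{\mathrm{inv}(\sigma)}.$$ -/

import Mathlib

open Polynomial

/-! ### Mixed dimer covers and face twists -/

section DimerCovers

variable {V : Type*} [Fintype V] [DecidableEq V] (G : SimpleGraph V) [DecidableRel G.Adj]

/-- A mixed dimer cover of the finite graph `G` with vertex multiplicities `m`: a multiset of edges
(a multiplicity for each edge of `G`) such that each vertex `v` is incident to exactly `m v` edges,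
counted with multiplicity. -/
@[ext]
structure DimerCover (m : V → ℕ) where
  mult : G.edgeSet → ℕ
  sum_incident : ∀ v : V, ∑ e ∈ Finset.univ.filter (fun e : G.edgeSet => v ∈ e.1), mult e = m v

instance DimerCover.instFinite (m : V → ℕ) : Finite (DimerCover G m) := by
  have hb : ∀ (ω : DimerCover G m) (e : G.edgeSet), ω.mult e ≤ ∑ v, m v := by
    rintro ω ⟨e, he⟩
    induction e using Sym2.ind with
    | _ x y =>
      calc ω.mult ⟨s(x, y), he⟩
          ≤ ∑ e' ∈ Finset.univ.filter (fun e' : G.edgeSet => x ∈ e'.1), ω.mult e' :=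
            Finset.single_le_sum (f := ω.mult) (fun _ _ => Nat.zero_le _) (by simp)
        _ = m x := ω.sum_incident x
        _ ≤ ∑ v, m v := Finset.single_le_sum (fun _ _ => Nat.zero_le _) (Finset.mem_univ x)
  refine Finite.of_injective
    (fun (ω : DimerCover G m) (e : G.edgeSet) =>
      (⟨ω.mult e, Nat.lt_succ_of_le (hb ω e)⟩ : Fin ((∑ v, m v) + 1))) ?_
  intro ω ω' h
  ext e
  exact congrArg Fin.val (congrFun h e)

noncomputable instance DimerCover.instFintype (m : V → ℕ) : Fintype (DimerCover G m) :=
  Fintype.ofFinite _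

variable {G}

/-- Let `F` be the boundary of a face, given as the set of its darts in counter-clockwise
direction. An edge of the face is even if it is traversed from a black vertex to a white one. -/
def IsEvenEdge (black : V → Prop) (F : Set G.Dart) (e : G.edgeSet) : Prop :=
  ∃ d ∈ F, d.edge = (e : Sym2 V) ∧ black d.fst

/-- An edge of the face is odd if it is traversed (counter-clockwise) from a white vertex to a
black one. -/
def IsOddEdge (black : V → Prop) (F : Set G.Dart) (e : G.edgeSet) : Prop :=
  ∃ d ∈ F, d.edge = (e : Sym2 V) ∧ ¬ black d.fst

/-- `ω'` is obtained from `ω` by a positive twist at the face `F`: the multiplicities of all odd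
edges of `F` (which are then necessarily positive in `ω`) decrease by one, those of all even edges
of `F` increase by one, and the others do not change. -/
def IsFaceTwist {m : V → ℕ} (black : V → Prop) (F : Set G.Dart) (ω ω' : DimerCover G m) : Prop :=
  (∀ e, IsOddEdge black F e → ω.mult e = ω'.mult e + 1) ∧
  (∀ e, IsEvenEdge black F e → ω'.mult e = ω.mult e + 1) ∧
  (∀ e, ¬ IsOddEdge black F e → ¬ IsEvenEdge black F e → ω'.mult e = ω.mult e)

end DimerCovers

/-! ### Zigzag snake graphs with the standard labeling -/

/-- The lower left corner of the `k`-th tile (`k = 0, 1, 2, …`) of a zigzag snake, drawn in the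
integer grid: `(0,0), (0,1), (1,1), (1,2), (2,2), …` (go up, right, up, right, …). -/
def tileCorner (k : ℕ) : ℕ × ℕ := (k / 2, (k + 1) / 2)

/-- The boundary of the unit square with lower left corner `c`, as directed edges in
counter-clockwise order: bottom, right, top, left. -/
def squareBoundary (c : ℕ × ℕ) : Finset ((ℕ × ℕ) × (ℕ × ℕ)) :=
  {((c.1, c.2), (c.1 + 1, c.2)), ((c.1 + 1, c.2), (c.1 + 1, c.2 + 1)),
   ((c.1 + 1, c.2 + 1), (c.1, c.2 + 1)), ((c.1, c.2 + 1), (c.1, c.2))}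

/-- The four vertices of the unit square with lower left corner `c`. -/
def squareVertices (c : ℕ × ℕ) : Finset (ℕ × ℕ) :=
  {(c.1, c.2), (c.1 + 1, c.2), (c.1 + 1, c.2 + 1), (c.1, c.2 + 1)}

/-- The vertices of the zigzag snake with `n` tiles: the corners of its tiles. The two endpoints of
the bottom edge of the first tile are always included; this matters only for `n = 0`, where the
snake is this single edge. -/
def zigzagVertices (n : ℕ) : Finset (ℕ × ℕ) :=
  {(0, 0), (1, 0)} ∪ (Finset.range n).biUnion fun k => squareVertices (tileCorner k)

abbrev ZigzagVertex (n : ℕ) : Type := {p : ℕ × ℕ // p ∈ zigzagVertices n}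

/-- Two points of the integer grid are adjacent if they are at distance one. -/
def GridAdj (p q : ℕ × ℕ) : Prop :=
  (p.1 = q.1 ∧ (p.2 + 1 = q.2 ∨ q.2 + 1 = p.2)) ∨ (p.2 = q.2 ∧ (p.1 + 1 = q.1 ∨ q.1 + 1 = p.1))

instance (p q : ℕ × ℕ) : Decidable (GridAdj p q) := by unfold GridAdj; infer_instance

/-- The zigzag snake graph with `n` tiles. Two of its vertices at distance one in the grid always
bound a common side of a tile, so it is an induced subgraph of the grid. -/
def zigzagGraph (n : ℕ) : SimpleGraph (ZigzagVertex n) where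
  Adj p q := GridAdj p q
  symm := ⟨fun p q h => by unfold GridAdj at *; omega⟩
  loopless := ⟨fun p h => by unfold GridAdj at *; omega⟩

instance (n : ℕ) : DecidableRel (zigzagGraph n).Adj := fun p q =>
  inferInstanceAs (Decidable (GridAdj p q))

/-- The standard vertex labeling of the zigzag snake with `n` tiles. The horizontal edges along the
lower right boundary, from `(j, j)` to `(j+1, j)`, have both endpoints labeled `2j+1`; the vertical
edges along the upper left boundary, from `(j, j+1)` to `(j, j+2)`, have both endpoints labeled
`2j+2`; except that the last label `n+1` is carried by the last two vertices of the last tile (its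
top edge for odd `n`, its right edge for even `n`). -/
def zigzagLabel (n : ℕ) (p : ZigzagVertex n) : ℕ :=
  min (n + 1) (if p.1.2 ≤ p.1.1 then 2 * p.1.2 + 1 else 2 * p.1.1 + 2)

/-- The black vertices are those with odd coordinate sum. This is the proper 2-coloring for which
the bottom right vertex `(j+1, j)` of the last tile is black if the number of tiles is odd, and the
top right vertex `(j+1, j+2)` of the last tile is black if the number of tiles is even. -/
def zigzagBlack (n : ℕ) (p : ZigzagVertex n) : Prop := Odd (p.1.1 + p.1.2)

/-- The (bounded) face of the zigzag snake given by its `k`-th tile, `k = 0, …, n-1`, as the set of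
its boundary darts in counter-clockwise direction. -/
def zigzagFace (n : ℕ) (k : Fin n) : Set (zigzagGraph n).Dart :=
  {d | ((d.fst : ℕ × ℕ), (d.snd : ℕ × ℕ)) ∈ squareBoundary (tileCorner k)}

/-- Mixed dimer covers of the zigzag snake with `n` tiles and the standard labeling. -/
abbrev ZigzagCover (n : ℕ) : Type := DimerCover (zigzagGraph n) (zigzagLabel n)

theorem squareVertices_subset {n : ℕ} (k : Fin n) {p : ℕ × ℕ}
    (hp : p ∈ squareVertices (tileCorner k)) : p ∈ zigzagVertices n :=
  Finset.mem_union_right _ (Finset.mem_biUnion.2 ⟨k, Finset.mem_range.2 k.2, hp⟩)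

/-- The vertex of the `k`-th tile at which the final edge of the snake formed by the tiles
`0, …, k` starts: bottom right if the number `k + 1` of these tiles is odd, top left otherwise. -/
def finalStart {n : ℕ} (k : Fin n) : ZigzagVertex n :=
  if Even (k : ℕ) then
    ⟨((tileCorner k).1 + 1, (tileCorner k).2), squareVertices_subset k (by simp [squareVertices])⟩
  else
    ⟨((tileCorner k).1, (tileCorner k).2 + 1), squareVertices_subset k (by simp [squareVertices])⟩

/-- The top right vertex of the `k`-th tile. -/
def finalStop {n : ℕ} (k : Fin n) : ZigzagVertex n :=
  ⟨((tileCorner k).1 + 1, (tileCorner k).2 + 1),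
    squareVertices_subset k (by simp [squareVertices])⟩

/-- The final edge of the snake formed by the tiles `0, …, k`, as an edge of the snake with `n`
tiles: the right edge of the `k`-th tile if the number `k + 1` of these tiles is odd, its top edge
if that number is even. -/
def finalEdge {n : ℕ} (k : Fin n) : (zigzagGraph n).edgeSet :=
  ⟨s(finalStart k, finalStop k), by
    rw [SimpleGraph.mem_edgeSet]
    show GridAdj _ _
    unfold finalStart finalStop GridAdj
    split_ifs <;> simp⟩

/-- A positive twist at the `k`-th tile. -/
def ZigzagTwist {n : ℕ} (k : Fin n) (ω ω' : ZigzagCover n) : Prop :=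
  IsFaceTwist (zigzagBlack n) (zigzagFace n k) ω ω'

theorem finalEdge_isEvenEdge {n : ℕ} (k : Fin n) :
    IsEvenEdge (zigzagBlack n) (zigzagFace n k) (finalEdge k) := by
  by_cases hk : Even (k : ℕ)
  · refine ⟨⟨(finalStart k, finalStop k), (finalEdge k).2⟩, ?_, rfl, ?_⟩
    · simp [zigzagFace, squareBoundary, finalStart, finalStop, hk]
    · simp only [zigzagBlack, finalStart, hk, if_true, tileCorner]
      obtain ⟨r, hr⟩ := hk
      exact ⟨r, by omega⟩
  · refine ⟨⟨(finalStop k, finalStart k), (finalEdge k).2.symm⟩, ?_, Sym2.eq_swap, ?_⟩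
    · simp [zigzagFace, squareBoundary, finalStart, finalStop, hk]
    · simp only [zigzagBlack, finalStop, tileCorner]
      obtain ⟨r, hr⟩ := Nat.not_even_iff_odd.1 hk
      exact ⟨r + 1, by omega⟩

theorem eq_of_finalEdge_mem_face {n : ℕ} {j k : Fin n} {d : (zigzagGraph n).Dart}
    (hd : d ∈ zigzagFace n k) (he : d.edge = (finalEdge j : Sym2 (ZigzagVertex n))) : j = k := by
  obtain ⟨⟨⟨⟨a, b⟩, ha⟩, ⟨⟨a', b'⟩, hb⟩⟩, hadj⟩ := d
  have hs : (finalStart j).1 = if Even (j : ℕ) then ((j : ℕ) / 2 + 1, ((j : ℕ) + 1) / 2)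
      else ((j : ℕ) / 2, ((j : ℕ) + 1) / 2 + 1) := by
    unfold finalStart tileCorner; split_ifs <;> rfl
  have ht : (finalStop j).1 = ((j : ℕ) / 2 + 1, ((j : ℕ) + 1) / 2 + 1) := rfl
  simp only [zigzagFace, squareBoundary, tileCorner, Set.mem_ofPred_eq, Finset.mem_insert,
    Finset.mem_singleton, Prod.mk.injEq] at hd
  simp only [SimpleGraph.Dart.edge, finalEdge, Sym2.eq, Sym2.rel_iff', Prod.mk.injEq,
    Prod.swap_prod_mk, Subtype.ext_iff, hs, ht] at he
  apply Fin.ext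
  by_cases hj : Even (j : ℕ)
  · simp only [hj, if_true, Prod.mk.injEq] at he
    obtain ⟨r, hr⟩ := hj
    omega
  · simp only [hj, if_false, Prod.mk.injEq] at he
    obtain ⟨r, hr⟩ := Nat.not_even_iff_odd.1 hj
    omega

theorem ZigzagTwist.sum_finalEdge {n : ℕ} {k : Fin n} {ω ω' : ZigzagCover n}
    (h : ZigzagTwist k ω ω') :
    ∑ j : Fin n, ω'.mult (finalEdge j) = ∑ j : Fin n, ω.mult (finalEdge j) + 1 := by
  have h1 : ∀ j : Fin n, ω'.mult (finalEdge j) = ω.mult (finalEdge j) + if j = k then 1 else 0 := by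
    intro j
    by_cases hj : j = k
    · subst hj
      simpa using h.2.1 _ (finalEdge_isEvenEdge j)
    · have h2 := h.2.2 (finalEdge j)
        (fun ⟨d, hd, he, _⟩ => hj (eq_of_finalEdge_mem_face hd he))
        (fun ⟨d, hd, he, _⟩ => hj (eq_of_finalEdge_mem_face hd he))
      simpa [hj] using h2
  simp [h1, Finset.sum_add_distrib]

/-- `ω'` is reached from `ω` by a (possibly empty) sequence of positive face twists. -/
def ZigzagReach {n : ℕ} (ω ω' : ZigzagCover n) : Prop :=
  Relation.ReflTransGen (fun α β : ZigzagCover n => ∃ k : Fin n, ZigzagTwist k α β) ω ω'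

theorem ZigzagReach.eq_or_lt {n : ℕ} {ω ω' : ZigzagCover n} (h : ZigzagReach ω ω') :
    ω = ω' ∨ ∑ j : Fin n, ω.mult (finalEdge j) < ∑ j : Fin n, ω'.mult (finalEdge j) := by
  induction h with
  | refl => exact Or.inl rfl
  | tail _ h2 ih =>
    obtain ⟨k, hk⟩ := h2
    have := hk.sum_finalEdge
    right
    rcases ih with rfl | ih <;> omega

/-- The face twist order on mixed dimer covers of the zigzag snake: the partial order generated by
the positive face twists. -/
instance (n : ℕ) : PartialOrder (ZigzagCover n) where
  le := ZigzagReach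
  le_refl _ := Relation.ReflTransGen.refl
  le_trans _ _ _ := Relation.ReflTransGen.trans
  le_antisymm ω ω' h h' := by
    rcases h.eq_or_lt with h1 | h1
    · exact h1
    · rcases h'.eq_or_lt with h2 | h2
      · exact h2.symm
      · omega

/-- `ω'` is reached from `ω` by exactly `r` positive face twists. -/
def ZigzagReachIn {n : ℕ} (r : ℕ) (ω ω' : ZigzagCover n) : Prop :=
  ∃ c : ℕ → ZigzagCover n, c 0 = ω ∧ c r = ω' ∧ ∀ i < r, ∃ k : Fin n, ZigzagTwist k (c i) (c (i + 1))

/-- The rank of `ω`: the minimal number of face twists needed to reach `ω` from the minimal element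
of the face twist order. -/
noncomputable def zigzagRank {n : ℕ} (ω : ZigzagCover n) : ℕ :=
  sInf {r | ∃ ω₀ : ZigzagCover n, IsBot ω₀ ∧ ZigzagReachIn r ω₀ ω}

/-- The rank generating function of the face twist order. -/
noncomputable def zigzagRankGenFun (n : ℕ) : ℕ[X] :=
  ∑ ω : ZigzagCover n, X ^ zigzagRank ω

/-! ### Permutations: Lehmer code, inversions, Bruhat order, pattern avoidance -/

section Permutations

variable {n : ℕ}

/-- The Lehmer code: `lehmerCode σ i` is the number of `j > i` with `σ j < σ i`. -/
def lehmerCode (σ : Equiv.Perm (Fin n)) (i : Fin n) : ℕ :=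
  (Finset.univ.filter fun j => i < j ∧ σ j < σ i).card

/-- The number of inversions. -/
def invCount (σ : Equiv.Perm (Fin n)) : ℕ :=
  (Finset.univ.filter fun p : Fin n × Fin n => p.1 < p.2 ∧ σ p.2 < σ p.1).card

/-- One step in the Bruhat order: multiplication by a transposition that increases the length
(the number of inversions). -/
def BruhatStep (σ τ : Equiv.Perm (Fin n)) : Prop :=
  (∃ i j : Fin n, i ≠ j ∧ τ = σ * Equiv.swap i j) ∧ invCount σ < invCount τ

/-- The (strong) Bruhat order on the symmetric group. -/
def BruhatLE (σ τ : Equiv.Perm (Fin n)) : Prop := Relation.ReflTransGen BruhatStep σ τ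

theorem BruhatLE.eq_or_lt {σ τ : Equiv.Perm (Fin n)} (h : BruhatLE σ τ) :
    σ = τ ∨ invCount σ < invCount τ := by
  induction h with
  | refl => exact Or.inl rfl
  | tail _ h2 ih =>
    right
    rcases ih with rfl | ih
    · exact h2.2
    · exact ih.trans h2.2

/-- `σ` is 132-avoiding: there are no positions `j < k < l` with `σ j < σ l < σ k`. -/
def Avoids132 (σ : Equiv.Perm (Fin n)) : Prop :=
  ∀ j k l : Fin n, j < k → k < l → ¬ (σ j < σ l ∧ σ l < σ k)

instance (σ : Equiv.Perm (Fin n)) : Decidable (Avoids132 σ) := by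
  unfold Avoids132; infer_instance

end Permutations

/-- The set `Cat_n` of 132-avoiding permutations in `S_n`. -/
@[ext]
structure CatPerm (n : ℕ) where
  perm : Equiv.Perm (Fin n)
  avoids : Avoids132 perm

/-- The restriction of the Bruhat order to 132-avoiding permutations. -/
instance (n : ℕ) : PartialOrder (CatPerm n) where
  le σ τ := BruhatLE σ.perm τ.perm
  le_refl _ := Relation.ReflTransGen.refl
  le_trans _ _ _ := Relation.ReflTransGen.trans
  le_antisymm σ τ h h' := by
    apply CatPerm.ext
    rcases h.eq_or_lt with h1 | h1
    · exact h1
    · rcases h'.eq_or_lt with h2 | h2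
      · exact h2.symm
      · omega

/-- The `q`-Catalan number `C_n(q)`, the inversion generating function of the 132-avoiding
permutations in `S_n`. -/
noncomputable def qCatalan (n : ℕ) : ℕ[X] :=
  ∑ σ : Equiv.Perm (Fin n) with Avoids132 σ, X ^ invCount σ

/-!
The corners of the tiles form a staircase path, and the `k`-th tile consists of two consecutive
edges of it and of one further vertex of degree two. The vertex conditions of a mixed dimer cover
can therefore be solved for all multiplicities in terms of those of the final edges
(`sum_incident_eq_label_iff`): if `f k` is the multiplicity of the final edge of the `k`-th tile,
the opposite multiplicity at its outer vertex is `k + 1 - f k`, and the multiplicities along the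
staircase are the differences of `0, f 0, f 1, …, f (n - 1), n + 1`. So covers amount to weakly
increasing sequences with `f k ≤ k + 1`, a positive twist at the `k`-th tile adds one to `f k`
(`zigzagTwist_iff`), and the face twist order is the componentwise order (`le_iff_profile_le`).

Reversed and extended by a zero, these sequences are the weakly decreasing Lehmer codes. Every
sequence with the right bounds is the code of exactly one permutation, and the code is weakly
decreasing if and only if the permutation avoids 132. For such a permutation, the `i`-th entry of
the code is the minimum of the values at the positions up to `i`.

On 132-avoiding permutations the Bruhat order is also the componentwise order of codes. Along any
Bruhat chain, even one that leaves the 132-avoiding permutations, prefix minima weakly increase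
(`BruhatLE.exists_apply_le`), so the codes of its ends are comparable (`BruhatLE.lehmerCode_le`).
Conversely, raising one entry of a Lehmer code by one is a Bruhat step
(`bruhatStep_of_lehmerCode_eq`): it exchanges `σ i` with the smallest larger value to its right.
Finally, the number of inversions is the sum of the code, which is the number of twists in any
chain from the least cover.
-/

/-! ### Lehmer codes -/

section LehmerCode

variable {n : ℕ} {σ τ : Equiv.Perm (Fin n)}

theorem lehmerCode_add_lt (σ : Equiv.Perm (Fin n)) (i : Fin n) : lehmerCode σ i + i < n := by
  have h : lehmerCode σ i ≤ (Finset.Ioi i).card :=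
    Finset.card_le_card fun j hj => by simpa using (Finset.mem_filter.1 hj).2.1
  rw [Fin.card_Ioi] at h
  omega

theorem sum_lehmerCode (σ : Equiv.Perm (Fin n)) : ∑ i, lehmerCode σ i = invCount σ := by
  simp only [invCount, lehmerCode, Finset.card_filter, Fintype.sum_prod_type]

/-- The value `σ i` is determined by the earlier values and the `i`-th entry of the code, which is
its rank among the values not used so far. -/
theorem lehmerCode_injective : Function.Injective (lehmerCode (n := n)) := by
  intro σ τ h
  -- The asymmetric half of the argument, at the first index where the permutations differ.
  have key : ∀ (σ τ : Equiv.Perm (Fin n)) (i : Fin n), (∀ j < i, σ j = τ j) →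
      lehmerCode σ i = lehmerCode τ i → ¬ σ i < τ i := by
    intro σ τ i hlt hi hστ
    have hpos : ∀ x, (∀ j < i, σ j ≠ x) → i ≤ τ.symm x := by
      intro x hx
      by_contra! hc
      exact hx _ hc (by rw [hlt _ hc, Equiv.apply_symm_apply])
    have hmem : i < τ.symm (σ i) := by
      refine lt_of_le_of_ne (hpos _ fun j hj h => hj.ne (σ.injective h)) fun h => ?_
      exact hστ.ne' ((Equiv.eq_symm_apply τ).1 h)
    refine hi.not_lt ?_
    unfold lehmerCode
    rw [← Finset.card_map (σ.trans τ.symm).toEmbedding]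
    refine Finset.card_lt_card ((Finset.ssubset_iff_of_subset ?_).2 ⟨τ.symm (σ i), ?_, ?_⟩)
    · intro x hx
      simp only [Finset.mem_map_equiv, Finset.mem_filter, Finset.mem_univ, true_and] at hx
      obtain ⟨y, rfl⟩ := (σ.trans τ.symm).surjective x
      simp only [Equiv.symm_apply_apply] at hx
      have h1 : i ≤ τ.symm (σ y) := hpos _ fun j hj h => by
        have := σ.injective h
        omega
      simp only [Finset.mem_filter, Finset.mem_univ, true_and, Equiv.trans_apply,
        Equiv.apply_symm_apply]
      refine ⟨lt_of_le_of_ne h1 fun h => ?_, hx.2.trans hστ⟩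
      exact (hx.2.trans hστ).ne' ((Equiv.eq_symm_apply τ).1 h)
    · simpa using ⟨hmem, hστ⟩
    · simp
  refine Equiv.ext fun i => ?_
  induction i using WellFoundedLT.induction with
  | _ i ih =>
    have h1 := key σ τ i ih (congrFun h i)
    have h2 := key τ σ i (fun j hj => (ih j hj).symm) (congrFun h i).symm
    exact le_antisymm (not_lt.1 h2) (not_lt.1 h1)

/-- Every bounded sequence is a Lehmer code, because there are `n!` of them. -/
theorem exists_lehmerCode_eq (c : Fin n → ℕ) (hc : ∀ i, c i + i < n) :
    ∃ σ : Equiv.Perm (Fin n), lehmerCode σ = c := by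
  let Φ : Equiv.Perm (Fin n) → (i : Fin n) → Fin (n - i) := fun σ i =>
    ⟨lehmerCode σ i, by have := lehmerCode_add_lt σ i; omega⟩
  have hinj : Function.Injective Φ := fun σ τ h =>
    lehmerCode_injective (funext fun i => congrArg Fin.val (congrFun h i))
  have hcard : Fintype.card (Equiv.Perm (Fin n)) = Fintype.card ((i : Fin n) → Fin (n - i)) := by
    rw [Fintype.card_perm, Fintype.card_pi, Fintype.card_fin]
    simp only [Fintype.card_fin]
    rw [Fin.prod_univ_eq_prod_range (fun i => n - i), ← Nat.descFactorial_eq_prod_range,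
      Nat.descFactorial_self]
  obtain ⟨σ, hσ⟩ := ((Fintype.bijective_iff_injective_and_card Φ).2 ⟨hinj, hcard⟩).surjective
    fun i => ⟨c i, by have := hc i; omega⟩
  exact ⟨σ, funext fun i => congrArg Fin.val (congrFun hσ i)⟩

/-- Together with `le_lehmerCode`, this says that the `i`-th entry of the Lehmer code of a
132-avoiding permutation is the minimum of its values at the positions up to `i`. -/
theorem Avoids132.lehmerCode_le (h : Avoids132 σ) {i j : Fin n} (hj : j ≤ i) :
    lehmerCode σ i ≤ σ j := by
  rw [← Fin.card_Iio, lehmerCode, ← Finset.card_map σ.toEmbedding]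
  refine Finset.card_le_card fun x hx => ?_
  obtain ⟨l, hl, rfl⟩ := Finset.mem_map.1 hx
  simp only [Finset.mem_filter, Finset.mem_univ, true_and] at hl
  simp only [Equiv.coe_toEmbedding, Finset.mem_Iio]
  by_contra! hc
  have hne : σ j ≠ σ l := fun e => by have := σ.injective e; omega
  have hji : j ≠ i := by rintro rfl; omega
  exact h j i l (by omega) hl.1 ⟨by omega, hl.2⟩

theorem le_lehmerCode {i : Fin n} {v : ℕ} (h : ∀ j ≤ i, v ≤ σ j) : v ≤ lehmerCode σ i := by
  have hv : v < n := (h i le_rfl).trans_lt (σ i).2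
  have hcard : (Finset.Iio (⟨v, hv⟩ : Fin n)).card = v := Fin.card_Iio _
  rw [← hcard, ← Finset.card_map σ.symm.toEmbedding]
  refine Finset.card_le_card fun x hx => ?_
  obtain ⟨y, hy, rfl⟩ := Finset.mem_map.1 hx
  simp only [Finset.mem_Iio, Fin.lt_def] at hy
  have hlt : i < σ.symm y := by
    by_contra! hc
    have := h _ hc
    rw [Equiv.apply_symm_apply] at this
    omega
  have := h i le_rfl
  exact Finset.mem_filter.2 ⟨Finset.mem_univ _, hlt, by
    rw [Equiv.coe_toEmbedding, Equiv.apply_symm_apply]; omega⟩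

theorem Avoids132.antitone_lehmerCode (h : Avoids132 σ) : Antitone (lehmerCode σ) :=
  fun _ _ hij => le_lehmerCode fun _ hj => h.lehmerCode_le (hj.trans hij)

theorem avoids132_of_antitone (h : Antitone (lehmerCode σ)) : Avoids132 σ := by
  -- In an occurrence `j < k < l` of the pattern with `k - j` minimal, no value between the
  -- positions `j` and `k` is below `σ j`, which forces the code to increase from `j` to `k`.
  suffices H : ∀ (d : ℕ) (j k l : Fin n), (k : ℕ) - j = d → j < k → k < l →
      ¬ (σ j < σ l ∧ σ l < σ k) from fun j k l => H _ j k l rfl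
  intro d
  induction d using Nat.strong_induction_on with
  | _ d ih =>
    rintro j k l hd hjk hkl ⟨h1, h2⟩
    refine (h hjk.le).not_gt (Finset.card_lt_card
      ((Finset.ssubset_iff_of_subset fun m hm => ?_).2 ⟨l, ?_, ?_⟩))
    · simp only [Finset.mem_filter, Finset.mem_univ, true_and] at hm ⊢
      refine ⟨?_, (hm.2.trans h1).trans h2⟩
      by_contra! hc
      have hmk : m ≠ k := by rintro rfl; exact (hm.2.trans h1).not_gt h2
      exact ih (k - m) (by omega) m k l rfl (by omega) hkl ⟨hm.2.trans h1, h2⟩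
    · simpa using ⟨hkl, h2⟩
    · simpa using fun _ => h1.le

end LehmerCode

/-! ### The Bruhat order and Lehmer codes -/

section Bruhat

variable {n : ℕ} {σ τ : Equiv.Perm (Fin n)}

theorem invCount_mul_swap_le {i j : Fin n} (hij : i < j) (h : σ j < σ i) :
    invCount (σ * Equiv.swap i j) ≤ invCount σ := by
  set s := Equiv.swap i j with hs
  have hsi : s i = j := Equiv.swap_apply_left i j
  have hsj : s j = i := Equiv.swap_apply_right i j
  have hsx : ∀ x, x ≠ i → x ≠ j → s x = x := fun x => Equiv.swap_apply_of_ne_of_ne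
  have hss : ∀ x, s (s x) = x := Equiv.swap_apply_self i j
  -- An inversion of `σ * s` is moved by `s` where this respects the order of the two positions;
  -- otherwise its positions already form an inversion of `σ`.
  refine Finset.card_le_card_of_injOn
    (fun p => if s p.1 < s p.2 then (s p.1, s p.2) else p) ?_ ?_
  · rintro ⟨p, q⟩ hpq
    replace hpq : p < q ∧ σ (s q) < σ (s p) := (Finset.mem_filter.1 (Finset.mem_coe.1 hpq)).2
    refine Finset.mem_coe.2 (Finset.mem_filter.2 ⟨Finset.mem_univ _, ?_⟩)
    dsimp only
    split_ifs with hc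
    · exact ⟨hc, hpq.2⟩
    · refine ⟨hpq.1, ?_⟩
      by_cases hp : p = i
      · subst hp
        by_cases hq : q = j
        · subst hq; exact h
        · have hq' := hsx q (by omega) hq
          rw [hsi, hq'] at hpq
          exact hpq.2.trans h
      · by_cases hp' : p = j
        · subst hp'
          have hq' := hsx q (by omega) (by omega)
          rw [hsj, hq'] at hc
          omega
        · have hpx := hsx p hp hp'
          by_cases hq : q = i
          · subst hq
            rw [hsi, hpx] at hc
            omega
          · by_cases hq' : q = j
            · subst hq'
              rw [hsj, hpx] at hpq
              exact h.trans hpq.2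
            · have hqx := hsx q hq hq'
              rw [hqx, hpx] at hpq
              exact hpq.2
  · rintro ⟨p, q⟩ hpq ⟨p', q'⟩ hpq' heq
    replace hpq := (Finset.mem_filter.1 (Finset.mem_coe.1 hpq)).2
    replace hpq' := (Finset.mem_filter.1 (Finset.mem_coe.1 hpq')).2
    dsimp only at heq hpq hpq'
    split_ifs at heq with h1 h2 h2
    · simpa using heq
    · simp only [Prod.mk.injEq] at heq
      rw [← heq.1, ← heq.2, hss, hss] at h2
      exact absurd hpq.1 h2
    · simp only [Prod.mk.injEq] at heq
      rw [heq.1, heq.2, hss, hss] at h1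
      exact absurd hpq'.1 h1
    · exact heq

/-- Prefix minima weakly increase in the Bruhat order: a step of it exchanges a value with a
larger one further to the right. -/
theorem BruhatLE.exists_apply_le (h : BruhatLE σ τ) (j : Fin n) : ∃ k ≤ j, σ k ≤ τ j := by
  induction h generalizing j with
  | refl => exact ⟨j, le_rfl, le_rfl⟩
  | @tail ρ τ _ hstep ih =>
    obtain ⟨⟨a, b, hab, rfl⟩, hinv⟩ := hstep
    -- The positions of the transposition can be assumed to be increasing.
    wlog hlt : a < b generalizing a b
    · rw [Equiv.swap_comm] at hinv ⊢
      exact this b a hab.symm hinv (by omega)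
    have hρ : ρ a < ρ b := by
      by_contra! hc
      have hne : ρ b ≠ ρ a := fun e => hab (ρ.injective e.symm)
      exact (invCount_mul_swap_le hlt (lt_of_le_of_ne hc hne)).not_gt hinv
    have hk : ∃ k ≤ j, ρ k ≤ (ρ * Equiv.swap a b) j := by
      rw [Equiv.Perm.mul_apply]
      by_cases hja : j = a
      · subst hja
        exact ⟨j, le_rfl, by rw [Equiv.swap_apply_left]; exact hρ.le⟩
      by_cases hjb : j = b
      · subst hjb
        exact ⟨a, hlt.le, by rw [Equiv.swap_apply_right]⟩
      · exact ⟨j, le_rfl, by rw [Equiv.swap_apply_of_ne_of_ne hja hjb]⟩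
    obtain ⟨k, hkj, hk⟩ := hk
    obtain ⟨l, hlk, hl⟩ := ih k
    exact ⟨l, hlk.trans hkj, hl.trans hk⟩

theorem BruhatLE.lehmerCode_le (h : BruhatLE σ τ) (hσ : Avoids132 σ) :
    lehmerCode σ ≤ lehmerCode τ := by
  intro i
  refine le_lehmerCode fun j hj => ?_
  obtain ⟨k, hk, hkj⟩ := h.exists_apply_le j
  exact (hσ.lehmerCode_le (hk.trans hj)).trans hkj

/-- If `σ j` is the smallest among the values larger than `σ i` and to the right of it, then
exchanging these two values raises the `i`-th entry of the Lehmer code by one and has no other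
effect on it. -/
theorem lehmerCode_mul_swap {i j : Fin n} (hij : i < j) (h : σ i < σ j)
    (hmin : ∀ k, i < k → σ i < σ k → σ j ≤ σ k) :
    lehmerCode (σ * Equiv.swap i j) = lehmerCode σ + Pi.single i 1 := by
  have hsx : ∀ x, x ≠ i → x ≠ j → (σ * Equiv.swap i j) x = σ x := fun x h1 h2 => by
    rw [Equiv.Perm.mul_apply, Equiv.swap_apply_of_ne_of_ne h1 h2]
  have hsi : (σ * Equiv.swap i j) i = σ j := by simp
  have hsj : (σ * Equiv.swap i j) j = σ i := by simp
  have hinj : ∀ {x y}, σ x = σ y → x = y := fun h => σ.injective h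
  set ρ := σ * Equiv.swap i j with hρ
  funext m
  simp only [Pi.add_apply]
  rcases lt_trichotomy m i with hm | rfl | hm
  · rw [Pi.single_eq_of_ne hm.ne, add_zero, lehmerCode, lehmerCode,
      ← Finset.card_map (Equiv.swap i j).toEmbedding]
    congr 1
    ext x
    have hx : m < Equiv.swap i j x ↔ m < x := by
      rw [Equiv.swap_apply_def]; split_ifs with h1 h2 <;> omega
    simp only [Finset.mem_map_equiv, Equiv.symm_swap, Finset.mem_filter, Finset.mem_univ, true_and,
      hx, hsx m hm.ne (by omega)]
    rw [hρ, Equiv.Perm.mul_apply, Equiv.swap_apply_self]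
  · rw [Pi.single_eq_same, lehmerCode, lehmerCode, ← Finset.card_insert_of_notMem (a := j)]
    · congr 1
      ext x
      simp only [Finset.mem_insert, Finset.mem_filter, Finset.mem_univ, true_and, hsi]
      by_cases hx : x = j
      · subst hx; simpa [hsj] using ⟨hij, h⟩
      · by_cases hmx : m < x
        · have h1 := hmin x hmx
          have h2 : σ x ≠ σ m := fun e => hmx.ne' (hinj e)
          rw [hsx x hmx.ne' hx]
          simp only [hx, hmx, false_or, true_and]
          omega
        · simp [hx, hmx]
    · simpa using fun _ => h.le
  · rw [Pi.single_eq_of_ne hm.ne', add_zero, lehmerCode, lehmerCode]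
    congr 1
    ext x
    simp only [Finset.mem_filter, Finset.mem_univ, true_and]
    refine and_congr_right fun hx => ?_
    -- No value to the right of `i` lies strictly between `σ i` and `σ j`.
    have hgap : ∀ y, i < y → y ≠ j → (σ y < σ i ↔ σ y < σ j) := fun y hy hyj => by
      have h1 := hmin y hy
      have h2 : σ y ≠ σ i := fun e => hy.ne' (hinj e)
      have h3 : σ y ≠ σ j := fun e => hyj (hinj e)
      omega
    by_cases hmj : m = j
    · subst hmj
      rw [hsj, hsx x (by omega) hx.ne', hgap x (by omega) hx.ne']
    · rw [hsx m hm.ne' hmj]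
      by_cases hxj : x = j
      · subst hxj
        rw [hsj]
        have h1 := hgap m hm hmj
        have h2 : σ m ≠ σ i := fun e => hm.ne' (hinj e)
        have h3 : σ m ≠ σ x := fun e => hmj (hinj e)
        omega
      · rw [hsx x (by omega) hxj]

theorem bruhatStep_of_lehmerCode_eq {i : Fin n}
    (h : lehmerCode τ = lehmerCode σ + Pi.single i 1) : BruhatStep σ τ := by
  -- Some value to the right of `i` is larger than `σ i`, as otherwise the entry is maximal.
  have hex : (Finset.univ.filter fun k => i < k ∧ σ i < σ k).Nonempty := by
    by_contra hc
    have hc' : ∀ k, i < k → σ k < σ i := fun k hk => by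
      have h1 : ¬ σ i < σ k := fun h => hc ⟨k, by simpa using ⟨hk, h⟩⟩
      have h2 : σ k ≠ σ i := fun e => hk.ne' (σ.injective e)
      omega
    have h1 : lehmerCode σ i = (Finset.Ioi i).card := by
      unfold lehmerCode
      congr 1
      ext k
      simpa using hc' k
    have h2 := lehmerCode_add_lt τ i
    rw [h, Pi.add_apply, Pi.single_eq_same, h1, Fin.card_Ioi] at h2
    omega
  obtain ⟨j, hj, hmin⟩ := Finset.exists_min_image _ σ hex
  simp only [Finset.mem_filter, Finset.mem_univ, true_and, and_imp] at hj hmin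
  have hτ : τ = σ * Equiv.swap i j :=
    lehmerCode_injective (h.trans (lehmerCode_mul_swap hj.1 hj.2 hmin).symm)
  refine ⟨⟨i, j, hj.1.ne, hτ⟩, ?_⟩
  rw [← sum_lehmerCode, ← sum_lehmerCode, h]
  simp [Finset.sum_add_distrib]

end Bruhat

/-! ### The edges of the zigzag snake -/

/-- The vertex of the `k`-th tile that belongs to no other tile, as the lower right vertex for even
`k` and the upper left one for odd `k`. The other three vertices of this tile are `tileCorner k`,
`tileCorner (k + 1)` and `tileCorner (k + 2)`: the corners of all tiles form a staircase path, and
each tile fills in two consecutive steps of it. -/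
def outerCorner (k : ℕ) : ℕ × ℕ := (k / 2 + 1 - k % 2, k / 2 + 2 * (k % 2))

theorem mem_squareVertices_tileCorner {k : ℕ} {p : ℕ × ℕ} :
    p ∈ squareVertices (tileCorner k) ↔
      p = tileCorner k ∨ p = outerCorner k ∨ p = tileCorner (k + 1) ∨ p = tileCorner (k + 2) := by
  obtain ⟨x, y⟩ := p
  simp only [squareVertices, tileCorner, outerCorner, Finset.mem_insert, Finset.mem_singleton,
    Prod.mk.injEq]
  omega

section Edges

variable {n : ℕ}

theorem mem_zigzagVertices_succ {p : ℕ × ℕ} :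
    p ∈ zigzagVertices (n + 1) ↔
      (∃ k : Fin (n + 3), p = tileCorner k) ∨ ∃ k : Fin (n + 1), p = outerCorner k := by
  simp only [zigzagVertices, Finset.mem_union, Finset.mem_biUnion, Finset.mem_range,
    mem_squareVertices_tileCorner, Finset.mem_insert, Finset.mem_singleton]
  constructor
  · rintro ((rfl | rfl) | ⟨k, hk, rfl | rfl | rfl | rfl⟩)
    · exact Or.inl ⟨⟨0, by omega⟩, by simp [tileCorner]⟩
    · exact Or.inr ⟨⟨0, by omega⟩, by simp [outerCorner]⟩
    · exact Or.inl ⟨⟨k, by omega⟩, rfl⟩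
    · exact Or.inr ⟨⟨k, hk⟩, rfl⟩
    · exact Or.inl ⟨⟨k + 1, by omega⟩, rfl⟩
    · exact Or.inl ⟨⟨k + 2, by omega⟩, rfl⟩
  · rintro (⟨⟨k, hk⟩, rfl⟩ | ⟨⟨k, hk⟩, rfl⟩)
    · right
      by_cases h0 : k < n + 1
      · exact ⟨k, h0, by simp⟩
      by_cases h1 : k = n + 1
      · exact ⟨n, by omega, by simp [h1]⟩
      · exact ⟨n, by omega, by simp [show k = n + 2 by omega]⟩
    · exact Or.inr ⟨k, hk, by simp⟩

/-- The vertices of the staircase path along the tiles of the snake. -/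
def spineVertex (k : Fin (n + 3)) : ZigzagVertex (n + 1) :=
  ⟨tileCorner k, mem_zigzagVertices_succ.2 (Or.inl ⟨k, rfl⟩)⟩

/-- The vertex of degree two that only the `k`-th tile contains. -/
def outerVertex (k : Fin (n + 1)) : ZigzagVertex (n + 1) :=
  ⟨outerCorner k, mem_zigzagVertices_succ.2 (Or.inr ⟨k, rfl⟩)⟩

theorem vertex_cases (v : ZigzagVertex (n + 1)) :
    (∃ k, v = spineVertex k) ∨ ∃ k, v = outerVertex k := by
  rcases mem_zigzagVertices_succ.1 v.2 with ⟨k, hk⟩ | ⟨k, hk⟩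
  · exact Or.inl ⟨k, Subtype.ext hk⟩
  · exact Or.inr ⟨k, Subtype.ext hk⟩

@[simp]
theorem spineVertex_inj {j k : Fin (n + 3)} :
    (spineVertex j : ZigzagVertex (n + 1)) = spineVertex k ↔ (j : ℕ) = k := by
  simp only [spineVertex, Subtype.ext_iff, tileCorner, Prod.mk.injEq]
  omega

@[simp]
theorem outerVertex_inj {j k : Fin (n + 1)} :
    outerVertex j = outerVertex k ↔ (j : ℕ) = k := by
  simp only [outerVertex, Subtype.ext_iff, outerCorner, Prod.mk.injEq]
  omega

@[simp]
theorem spineVertex_ne_outerVertex {j : Fin (n + 3)} {k : Fin (n + 1)} :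
    spineVertex j ≠ outerVertex k := by
  simp only [spineVertex, outerVertex, ne_eq, Subtype.ext_iff, tileCorner, outerCorner,
    Prod.mk.injEq]
  omega

@[simp]
theorem outerVertex_ne_spineVertex {j : Fin (n + 3)} {k : Fin (n + 1)} :
    outerVertex k ≠ spineVertex j :=
  spineVertex_ne_outerVertex.symm

/-- The edge of the `k`-th tile that joins its lower left corner to its outer vertex. -/
def startEdge (k : Fin (n + 1)) : (zigzagGraph (n + 1)).edgeSet :=
  ⟨s(spineVertex ⟨k, by omega⟩, outerVertex k), by
    rw [SimpleGraph.mem_edgeSet]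
    show GridAdj (tileCorner k) (outerCorner k)
    simp only [GridAdj, tileCorner, outerCorner]
    omega⟩

/-- The `k`-th edge of the staircase path. For `0 < k < n + 1` the tiles `k - 1` and `k` share
it. -/
def spineEdge (k : Fin (n + 2)) : (zigzagGraph (n + 1)).edgeSet :=
  ⟨s(spineVertex k.castSucc, spineVertex k.succ), by
    rw [SimpleGraph.mem_edgeSet]
    show GridAdj (tileCorner k) (tileCorner (k + 1))
    simp only [GridAdj, tileCorner]
    omega⟩

theorem coe_finalEdge (k : Fin (n + 1)) :
    (finalEdge k : Sym2 (ZigzagVertex (n + 1))) =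
      s(outerVertex k, spineVertex ⟨k + 2, by omega⟩) := by
  have h1 : finalStart k = outerVertex k := by
    rw [Subtype.ext_iff]
    unfold finalStart
    split_ifs with h
    · rw [Nat.even_iff] at h
      simp only [outerVertex, tileCorner, outerCorner, Prod.mk.injEq]
      omega
    · rw [Nat.even_iff] at h
      simp only [outerVertex, tileCorner, outerCorner, Prod.mk.injEq]
      omega
  have h2 : finalStop k = spineVertex ⟨k + 2, by omega⟩ := by
    rw [Subtype.ext_iff]
    simp only [finalStop, spineVertex, tileCorner, Prod.mk.injEq]
    omega
  rw [← h1, ← h2]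
  rfl

theorem edge_cases (e : (zigzagGraph (n + 1)).edgeSet) :
    (∃ k, e = startEdge k) ∨ (∃ k, e = finalEdge k) ∨ ∃ k, e = spineEdge k := by
  obtain ⟨e, he⟩ := e
  induction e using Sym2.ind with
  | _ p q =>
    have hadj : GridAdj p q := he
    simp only [Subtype.ext_iff, coe_finalEdge, startEdge, spineEdge]
    rcases vertex_cases p with ⟨a, rfl⟩ | ⟨a, rfl⟩ <;>
      rcases vertex_cases q with ⟨b, rfl⟩ | ⟨b, rfl⟩
    · simp only [spineVertex, GridAdj, tileCorner] at hadj
      have : (a : ℕ) + 1 = b ∨ (b : ℕ) + 1 = a := by omega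
      rcases this with h | h
      · exact Or.inr (Or.inr ⟨⟨a, by omega⟩, by simp [h]⟩)
      · exact Or.inr (Or.inr ⟨⟨b, by omega⟩, by simp [h]⟩)
    · simp only [spineVertex, outerVertex, GridAdj, tileCorner, outerCorner] at hadj
      have : (a : ℕ) = b ∨ (a : ℕ) = b + 2 := by omega
      rcases this with h | h
      · exact Or.inl ⟨b, by simp [h]⟩
      · exact Or.inr (Or.inl ⟨b, by simp [h]⟩)
    · simp only [spineVertex, outerVertex, GridAdj, tileCorner, outerCorner] at hadj
      have : (b : ℕ) = a ∨ (b : ℕ) = a + 2 := by omega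
      rcases this with h | h
      · exact Or.inl ⟨a, by simp [h]⟩
      · exact Or.inr (Or.inl ⟨a, by simp [h]⟩)
    · simp only [outerVertex, GridAdj, outerCorner] at hadj
      omega

variable (n) in
/-- The edges of the snake: a start edge and a final edge for each tile, and the edges of the
staircase path. -/
noncomputable def edgeEquiv :
    Fin (n + 1) ⊕ Fin (n + 1) ⊕ Fin (n + 2) ≃ (zigzagGraph (n + 1)).edgeSet :=
  Equiv.ofBijective (Sum.elim startEdge (Sum.elim finalEdge spineEdge)) <| by
    constructor
    · rintro (j | j | j) (k | k | k) h <;> replace h := congrArg Subtype.val h <;>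
        simp [startEdge, spineEdge, coe_finalEdge] at h ⊢ <;> omega
    · intro e
      rcases edge_cases e with ⟨k, rfl⟩ | ⟨k, rfl⟩ | ⟨k, rfl⟩
      exacts [⟨Sum.inl k, rfl⟩, ⟨Sum.inr (Sum.inl k), rfl⟩, ⟨Sum.inr (Sum.inr k), rfl⟩]

theorem sum_edges (m : (zigzagGraph (n + 1)).edgeSet → ℕ) :
    ∑ e, m e = ∑ k, m (startEdge k) + (∑ k, m (finalEdge k) + ∑ k, m (spineEdge k)) := by
  rw [← (edgeEquiv n).sum_comp, Fintype.sum_sum_type, Fintype.sum_sum_type]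
  rfl

end Edges

/-! ### Covers as monotone sequences -/

section Covers

variable {n : ℕ}

/-- The sequence `0, f 0, …, f n, n + 2, n + 2, …`. For the multiplicities `f` of the final edges
of a cover, its differences are the multiplicities along the staircase path. -/
def padded (f : Fin (n + 1) → ℕ) : ℕ → ℕ
  | 0 => 0
  | k + 1 => if h : k < n + 1 then f ⟨k, h⟩ else n + 2

theorem padded_succ (f : Fin (n + 1) → ℕ) (k : Fin (n + 1)) : padded f (k + 1) = f k :=
  dif_pos k.2

theorem padded_last (f : Fin (n + 1) → ℕ) : padded f (n + 1 + 1) = n + 2 := by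
  simp [padded]

theorem sum_fin_ite_eq_add (N a c : ℕ) (g : ℕ → ℕ) :
    ∑ k : Fin N, (if a = k + c then g k else 0) = if c ≤ a ∧ a < N + c then g (a - c) else 0 := by
  rw [Fin.sum_univ_eq_sum_range fun k => if a = k + c then g k else 0]
  by_cases h : c ≤ a
  · obtain ⟨b, rfl⟩ := Nat.exists_eq_add_of_le' h
    simp
  · rw [if_neg (by omega)]
    exact Finset.sum_eq_zero fun k _ => if_neg (by omega)

theorem sum_incident_outerVertex (m : (zigzagGraph (n + 1)).edgeSet → ℕ) (k : Fin (n + 1)) :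
    ∑ e ∈ Finset.univ.filter (fun e : (zigzagGraph (n + 1)).edgeSet => outerVertex k ∈ e.1), m e =
      m (startEdge k) + m (finalEdge k) := by
  rw [Finset.sum_filter, sum_edges]
  simp only [startEdge, spineEdge, coe_finalEdge, Sym2.mem_iff, outerVertex_ne_spineVertex,
    outerVertex_inj, ← Fin.ext_iff, false_or, or_false, Finset.sum_ite_eq, Finset.mem_univ, if_true,
    if_false, Finset.sum_const_zero, add_zero]

theorem sum_incident_spineVertex (m : (zigzagGraph (n + 1)).edgeSet → ℕ) {b t : ℕ → ℕ}
    (hb : ∀ k : Fin (n + 1), m (startEdge k) = b k) (ht : ∀ k : Fin (n + 2), m (spineEdge k) = t k)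
    (a : Fin (n + 3)) :
    ∑ e ∈ Finset.univ.filter (fun e : (zigzagGraph (n + 1)).edgeSet => spineVertex a ∈ e.1), m e =
      (if (a : ℕ) < n + 1 then b a else 0) +
      ((if 2 ≤ (a : ℕ) then padded (fun k => m (finalEdge k)) (a - 1) else 0) +
      ((if (a : ℕ) < n + 2 then t a else 0) + if 1 ≤ (a : ℕ) then t (a - 1) else 0)) := by
  have h1 : ∀ k : Fin (n + 1), (if spineVertex a ∈ (startEdge k).1 then m (startEdge k) else 0) =
      if (a : ℕ) = k + 0 then b k else 0 := fun k => by simp [startEdge, ← hb]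
  have h2 : ∀ k : Fin (n + 1), (if spineVertex a ∈ (finalEdge k).1 then m (finalEdge k) else 0) =
      if (a : ℕ) = k + 2 then padded (fun k => m (finalEdge k)) (k + 1) else 0 := fun k => by
    simp [coe_finalEdge, padded_succ]
  have h3 : ∀ k : Fin (n + 2), (if spineVertex a ∈ (spineEdge k).1 then m (spineEdge k) else 0) =
      (if (a : ℕ) = k + 0 then t k else 0) + if (a : ℕ) = k + 1 then t k else 0 := fun k => by
    simp only [spineEdge, Sym2.mem_iff, spineVertex_inj, Fin.val_castSucc, Fin.val_succ, ← ht,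
      add_zero]
    split_ifs <;> omega
  rw [Finset.sum_filter, sum_edges]
  simp only [h1, h2, h3, Finset.sum_add_distrib]
  rw [sum_fin_ite_eq_add, sum_fin_ite_eq_add (n + 1) a 2
    fun k => padded (fun k => m (finalEdge k)) (k + 1), sum_fin_ite_eq_add, sum_fin_ite_eq_add]
  have ha := a.2
  congr 1
  · simp
  congr 1
  · by_cases h : 2 ≤ (a : ℕ)
    · rw [if_pos ⟨h, by omega⟩, if_pos h, show (a : ℕ) - 2 + 1 = a - 1 by omega]
    · rw [if_neg (by omega), if_neg h]
  congr 1
  · simp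
  · by_cases h : 1 ≤ (a : ℕ)
    · rw [if_pos ⟨h, by omega⟩, if_pos h]
    · rw [if_neg (by omega), if_neg h]

theorem zigzagLabel_spineVertex (k : Fin (n + 3)) :
    zigzagLabel (n + 1) (spineVertex k) = min (n + 2) (k + 1) := by
  unfold zigzagLabel
  split_ifs with h <;> simp only [spineVertex, tileCorner] at h ⊢ <;> omega

theorem zigzagLabel_outerVertex (k : Fin (n + 1)) :
    zigzagLabel (n + 1) (outerVertex k) = k + 1 := by
  unfold zigzagLabel
  split_ifs with h <;> simp only [outerVertex, outerCorner] at h ⊢ <;> omega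

/-- The vertex conditions of a cover, solved for the multiplicities of the start edges and of the
edges of the staircase path. -/
theorem sum_incident_eq_label_iff (m : (zigzagGraph (n + 1)).edgeSet → ℕ) :
    (∀ v, ∑ e ∈ Finset.univ.filter (fun e : (zigzagGraph (n + 1)).edgeSet => v ∈ e.1), m e =
      zigzagLabel (n + 1) v) ↔
    (∀ k, m (startEdge k) + m (finalEdge k) = k + 1) ∧
      ∀ k : Fin (n + 2), m (spineEdge k) + padded (fun k => m (finalEdge k)) k =
        padded (fun k => m (finalEdge k)) (k + 1) := by
  obtain ⟨b, hb⟩ : ∃ b : ℕ → ℕ, ∀ k : Fin (n + 1), m (startEdge k) = b k :=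
    ⟨fun k => if h : k < n + 1 then m (startEdge ⟨k, h⟩) else 0, fun k => by
      dsimp only; rw [dif_pos k.2]⟩
  obtain ⟨t, ht⟩ : ∃ t : ℕ → ℕ, ∀ k : Fin (n + 2), m (spineEdge k) = t k :=
    ⟨fun k => if h : k < n + 2 then m (spineEdge ⟨k, h⟩) else 0, fun k => by
      dsimp only; rw [dif_pos k.2]⟩
  have hspine := sum_incident_spineVertex m hb ht
  have hf := padded_succ fun k => m (finalEdge k)
  have hlast := padded_last fun k => m (finalEdge k)
  have h0 : padded (fun k => m (finalEdge k)) 0 = 0 := rfl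
  simp only [ht, hb]
  set P := padded fun k => m (finalEdge k)
  constructor
  · intro h
    have hout : ∀ k : Fin (n + 1), b k + P (k + 1) = k + 1 := fun k => by
      rw [hf, ← hb, ← sum_incident_outerVertex, h, zigzagLabel_outerVertex]
    refine ⟨fun k => by rw [← hf, hout], ?_⟩
    rintro ⟨k, hk⟩
    dsimp only
    induction k with
    | zero =>
      have h1 := h (spineVertex 0)
      rw [hspine, zigzagLabel_spineVertex] at h1
      have h2 := hout 0
      simp at h1 h2 ⊢
      omega
    | succ k ih =>
      have ih := ih (by omega)
      by_cases hkn : k = n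
      · subst hkn
        have h1 := h (spineVertex ⟨k + 2, by omega⟩)
        rw [hspine, zigzagLabel_spineVertex] at h1
        simp at h1
        omega
      · have h1 := h (spineVertex ⟨k + 1, by omega⟩)
        rw [hspine, zigzagLabel_spineVertex] at h1
        have h2 := hout ⟨k + 1, by omega⟩
        dsimp only at h1 h2
        rw [if_pos (by omega : k + 1 < n + 1), if_pos (by omega : k + 1 < n + 2),
          if_pos (by omega : 1 ≤ k + 1), Nat.add_sub_cancel] at h1
        rcases k with _ | k
        · simp only [zero_add] at *
          simp at h1
          omega
        · rw [if_pos (by omega)] at h1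
          omega
  · rintro ⟨hout, ht'⟩ v
    rcases vertex_cases v with ⟨⟨k, hk⟩, rfl⟩ | ⟨k, rfl⟩
    · rw [hspine, zigzagLabel_spineVertex]
      dsimp only
      have e1 : ∀ j, j < n + 1 → b j + P (j + 1) = j + 1 := fun j hj => by
        have := hout ⟨j, hj⟩
        rwa [← hf] at this
      have e2 : ∀ j, j < n + 2 → t j + P j = P (j + 1) := fun j hj => ht' ⟨j, hj⟩
      rcases k with _ | k
      · have := e1 0 (by omega)
        have := e2 0 (by omega)
        simp
        omega
      · have h2 := e2 k (by omega)
        have hP : (if 2 ≤ k + 1 then P (k + 1 - 1) else 0) = P k := by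
          rcases k with _ | k
          · simp [h0]
          · simp
        rw [hP, if_pos (by omega : 1 ≤ k + 1), Nat.add_sub_cancel]
        by_cases h1 : k + 1 < n + 1
        · have := e1 (k + 1) h1
          have := e2 (k + 1) (by omega)
          rw [if_pos h1, if_pos (by omega)]
          omega
        · rw [if_neg h1]
          by_cases h3 : k = n
          · subst h3
            have := e2 (k + 1) (by omega)
            rw [if_pos (by omega)]
            omega
          · obtain rfl : k = n + 1 := by omega
            rw [if_neg (by omega)]
            omega
    · rw [sum_incident_outerVertex, zigzagLabel_outerVertex, hb, hout]

/-- The multiplicities of the final edges in a cover. -/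
def profile {n : ℕ} (ω : ZigzagCover n) (k : Fin n) : ℕ := ω.mult (finalEdge k)

theorem mult_startEdge_add (ω : ZigzagCover (n + 1)) (k : Fin (n + 1)) :
    ω.mult (startEdge k) + profile ω k = k + 1 :=
  ((sum_incident_eq_label_iff ω.mult).1 ω.sum_incident).1 k

theorem mult_spineEdge_add (ω : ZigzagCover (n + 1)) (k : Fin (n + 2)) :
    ω.mult (spineEdge k) + padded (profile ω) k = padded (profile ω) (k + 1) :=
  ((sum_incident_eq_label_iff ω.mult).1 ω.sum_incident).2 k

theorem profile_le {n : ℕ} (ω : ZigzagCover n) (k : Fin n) : profile ω k ≤ k + 1 := by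
  cases n with
  | zero => exact k.elim0
  | succ n => have := mult_startEdge_add ω k; omega

theorem monotone_profile {n : ℕ} (ω : ZigzagCover n) : Monotone (profile ω) := by
  cases n with
  | zero => exact fun k => k.elim0
  | succ n =>
    refine Fin.monotone_iff_le_succ.2 fun k => ?_
    have := mult_spineEdge_add ω k.succ.castSucc
    have h1 := padded_succ (profile ω) k.castSucc
    have h2 := padded_succ (profile ω) k.succ
    simp only [Fin.val_castSucc, Fin.val_succ] at *
    omega

/-- The snake without tiles is a single edge, and it is incident to both vertices. -/
theorem sum_incident_zero (m : (zigzagGraph 0).edgeSet → ℕ) (v : ZigzagVertex 0)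
    (e : (zigzagGraph 0).edgeSet) :
    ∑ e ∈ Finset.univ.filter (fun e : (zigzagGraph 0).edgeSet => v ∈ e.1), m e = m e := by
  have hv : ∀ v : ZigzagVertex 0, v = ⟨(0, 0), by decide⟩ ∨ v = ⟨(1, 0), by decide⟩ := by decide
  have he : ∀ e : (zigzagGraph 0).edgeSet,
      (e : Sym2 (ZigzagVertex 0)) = s(⟨(0, 0), by decide⟩, ⟨(1, 0), by decide⟩) := by
    rintro ⟨e, he⟩
    induction e using Sym2.ind with
    | _ p q =>
      have hadj : GridAdj p q := he
      rcases hv p with rfl | rfl <;> rcases hv q with rfl | rfl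
      · simp [GridAdj] at hadj
      · rfl
      · exact Sym2.eq_swap
      · simp [GridAdj] at hadj
  have : Subsingleton (zigzagGraph 0).edgeSet :=
    ⟨fun e e' => Subtype.ext ((he e).trans (he e').symm)⟩
  rw [Finset.filter_true_of_mem fun e _ => ?_, Fintype.sum_subsingleton _ e]
  rw [he, Sym2.mem_iff]
  exact hv v

theorem zigzagLabel_zero (v : ZigzagVertex 0) : zigzagLabel 0 v = 1 := by
  unfold zigzagLabel
  split_ifs <;> omega

theorem profile_injective {n : ℕ} : Function.Injective (profile (n := n)) := by
  intro ω ω' h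
  cases n with
  | zero =>
    ext e
    have h1 := sum_incident_zero ω.mult (Quot.out e.1).1 e
    have h2 := sum_incident_zero ω'.mult (Quot.out e.1).1 e
    rw [← h1, ← h2, ω.sum_incident, ω'.sum_incident]
  | succ n =>
    ext e
    rcases edge_cases e with ⟨k, rfl⟩ | ⟨k, rfl⟩ | ⟨k, rfl⟩
    · have h1 := mult_startEdge_add ω k
      have h2 := mult_startEdge_add ω' k
      rw [h] at h1
      omega
    · exact congrFun h k
    · have h1 := mult_spineEdge_add ω k
      have h2 := mult_spineEdge_add ω' k
      rw [h] at h1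
      omega

theorem exists_profile_eq {n : ℕ} {f : Fin n → ℕ} (hmono : Monotone f) (hle : ∀ k, f k ≤ k + 1) :
    ∃ ω : ZigzagCover n, profile ω = f := by
  cases n with
  | zero =>
    exact ⟨⟨fun _ => 1, fun v => (sum_incident_zero (fun _ => 1) v ⟨s(⟨(0, 0), by decide⟩,
      ⟨(1, 0), by decide⟩), by decide⟩).trans (zigzagLabel_zero v).symm⟩, Subsingleton.elim _ _⟩
  | succ n =>
    let m : (zigzagGraph (n + 1)).edgeSet → ℕ := fun e =>
      Sum.elim (fun k : Fin (n + 1) => k + 1 - f k)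
        (Sum.elim f fun k : Fin (n + 2) => padded f (k + 1) - padded f k) ((edgeEquiv n).symm e)
    have h1 : ∀ k, m (startEdge k) = k + 1 - f k := fun k =>
      congrArg (Sum.elim _ _) ((edgeEquiv n).symm_apply_apply (Sum.inl k))
    have h2 : ∀ k, m (finalEdge k) = f k := fun k =>
      congrArg (Sum.elim _ _) ((edgeEquiv n).symm_apply_apply (Sum.inr (Sum.inl k)))
    have h3 : ∀ k : Fin (n + 2), m (spineEdge k) = padded f (k + 1) - padded f k := fun k =>
      congrArg (Sum.elim _ _) ((edgeEquiv n).symm_apply_apply (Sum.inr (Sum.inr k)))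
    refine ⟨⟨m, (sum_incident_eq_label_iff m).2 ⟨fun k => ?_, ?_⟩⟩, funext h2⟩
    · have := hle k
      rw [h1, h2]
      omega
    · rintro ⟨k, hk⟩
      rw [funext h2, h3]
      refine Nat.sub_add_cancel ?_
      dsimp only
      rcases k with _ | k
      · exact Nat.zero_le _
      · simp only [padded]
        split_ifs with h4 h5
        · exact hmono (by simp)
        · have := hle ⟨k, h4⟩
          dsimp only at this
          omega
        · omega
        · omega

end Covers

/-! ### Twists of a cover -/

section Twists

variable {n : ℕ}

/-- The darts of a tile that start at a black vertex. -/
theorem mem_face_and_black_iff (k : Fin (n + 1)) (p q : ZigzagVertex (n + 1)) :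
    ((p : ℕ × ℕ), (q : ℕ × ℕ)) ∈ squareBoundary (tileCorner k) ∧ zigzagBlack (n + 1) p ↔
      if (k : ℕ) % 2 = 0 then
        (p = outerVertex k ∧ q = spineVertex ⟨k + 2, by omega⟩) ∨
          (p = spineVertex ⟨k + 1, by omega⟩ ∧ q = spineVertex ⟨k, by omega⟩)
      else
        (p = spineVertex ⟨k + 2, by omega⟩ ∧ q = outerVertex k) ∨
          (p = spineVertex ⟨k, by omega⟩ ∧ q = spineVertex ⟨k + 1, by omega⟩) := by
  obtain ⟨⟨a, b⟩, hp⟩ := p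
  obtain ⟨⟨c, d⟩, hq⟩ := q
  simp only [zigzagBlack, Nat.odd_iff, squareBoundary, Finset.mem_insert, Finset.mem_singleton,
    outerVertex, spineVertex, Subtype.mk.injEq, Prod.mk.injEq, tileCorner, outerCorner]
  split_ifs <;> omega

/-- The darts of a tile that start at a white vertex. -/
theorem mem_face_and_not_black_iff (k : Fin (n + 1)) (p q : ZigzagVertex (n + 1)) :
    ((p : ℕ × ℕ), (q : ℕ × ℕ)) ∈ squareBoundary (tileCorner k) ∧ ¬ zigzagBlack (n + 1) p ↔
      if (k : ℕ) % 2 = 0 then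
        (p = spineVertex ⟨k, by omega⟩ ∧ q = outerVertex k) ∨
          (p = spineVertex ⟨k + 2, by omega⟩ ∧ q = spineVertex ⟨k + 1, by omega⟩)
      else
        (p = outerVertex k ∧ q = spineVertex ⟨k, by omega⟩) ∨
          (p = spineVertex ⟨k + 1, by omega⟩ ∧ q = spineVertex ⟨k + 2, by omega⟩) := by
  obtain ⟨⟨a, b⟩, hp⟩ := p
  obtain ⟨⟨c, d⟩, hq⟩ := q
  simp only [zigzagBlack, Nat.odd_iff, squareBoundary, Finset.mem_insert, Finset.mem_singleton,
    outerVertex, spineVertex, Subtype.mk.injEq, Prod.mk.injEq, tileCorner, outerCorner]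
  split_ifs <;> omega

theorem isEvenEdge_iff (k : Fin (n + 1)) (e : (zigzagGraph (n + 1)).edgeSet) :
    IsEvenEdge (zigzagBlack (n + 1)) (zigzagFace (n + 1) k) e ↔
      e = finalEdge k ∨ e = spineEdge k.castSucc := by
  rw [Subtype.ext_iff, Subtype.ext_iff, coe_finalEdge]
  constructor
  · rintro ⟨⟨⟨p, q⟩, h⟩, hd, he, hb⟩
    have := (mem_face_and_black_iff k p q).1 ⟨hd, hb⟩
    rw [← he]
    split_ifs at this <;> rcases this with ⟨rfl, rfl⟩ | ⟨rfl, rfl⟩ <;>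
      simp [SimpleGraph.Dart.edge, spineEdge]
  · rintro (h | h)
    · rw [← coe_finalEdge, ← Subtype.ext_iff] at h
      exact h ▸ finalEdge_isEvenEdge k
    · rw [← Subtype.ext_iff] at h
      subst h
      by_cases hk : (k : ℕ) % 2 = 0
      · have := (mem_face_and_black_iff k (spineVertex ⟨k + 1, by omega⟩)
          (spineVertex ⟨k, by omega⟩)).2 (by rw [if_pos hk]; simp)
        exact ⟨⟨(_, _), (spineEdge k.castSucc).2.symm⟩, this.1, Sym2.eq_swap, this.2⟩
      · have := (mem_face_and_black_iff k (spineVertex ⟨k, by omega⟩)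
          (spineVertex ⟨k + 1, by omega⟩)).2 (by rw [if_neg hk]; simp)
        exact ⟨⟨(_, _), (spineEdge k.castSucc).2⟩, this.1, rfl, this.2⟩

theorem isOddEdge_iff (k : Fin (n + 1)) (e : (zigzagGraph (n + 1)).edgeSet) :
    IsOddEdge (zigzagBlack (n + 1)) (zigzagFace (n + 1) k) e ↔
      e = startEdge k ∨ e = spineEdge k.succ := by
  constructor
  · rintro ⟨⟨⟨p, q⟩, h⟩, hd, he, hb⟩
    have := (mem_face_and_not_black_iff k p q).1 ⟨hd, hb⟩
    rw [Subtype.ext_iff, Subtype.ext_iff, ← he]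
    split_ifs at this <;> rcases this with ⟨rfl, rfl⟩ | ⟨rfl, rfl⟩ <;>
      simp [SimpleGraph.Dart.edge, spineEdge, startEdge]
  · have key := mem_face_and_not_black_iff k
    by_cases hk : (k : ℕ) % 2 = 0
    · simp only [if_pos hk] at key
      rintro (rfl | rfl)
      · have := (key _ _).2 (Or.inl ⟨rfl, rfl⟩)
        exact ⟨⟨(_, _), (startEdge k).2⟩, this.1, rfl, this.2⟩
      · have := (key _ _).2 (Or.inr ⟨rfl, rfl⟩)
        exact ⟨⟨(_, _), (spineEdge k.succ).2.symm⟩, this.1, Sym2.eq_swap, this.2⟩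
    · simp only [if_neg hk] at key
      rintro (rfl | rfl)
      · have := (key _ _).2 (Or.inl ⟨rfl, rfl⟩)
        exact ⟨⟨(_, _), (startEdge k).2.symm⟩, this.1, Sym2.eq_swap, this.2⟩
      · have := (key _ _).2 (Or.inr ⟨rfl, rfl⟩)
        exact ⟨⟨(_, _), (spineEdge k.succ).2⟩, this.1, rfl, this.2⟩

theorem zigzagTwist_iff {n : ℕ} (k : Fin n) (ω ω' : ZigzagCover n) :
    ZigzagTwist k ω ω' ↔ profile ω' = profile ω + Pi.single k 1 := by
  cases n with
  | zero => exact k.elim0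
  | succ n =>
    constructor
    · intro h
      funext j
      by_cases hj : j = k
      · subst hj
        simpa [profile] using h.2.1 _ (finalEdge_isEvenEdge j)
      · have h2 := h.2.2 (finalEdge j)
          (fun ⟨d, hd, he, _⟩ => hj (eq_of_finalEdge_mem_face hd he))
          (fun ⟨d, hd, he, _⟩ => hj (eq_of_finalEdge_mem_face hd he))
        simpa [profile, hj] using h2
    · intro h
      have hf : ∀ j, profile ω' j = profile ω j + if (j : ℕ) = k then 1 else 0 := fun j => by
        simp [h, Pi.single_apply, Fin.ext_iff]
      have hpad : ∀ j, padded (profile ω') j =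
          padded (profile ω) j + if j = k + 1 then 1 else 0 := by
        rintro (_ | j)
        · simp [padded]
        · simp only [padded, hf, Nat.add_right_cancel_iff]
          split_ifs <;> omega
      have hstart : ∀ j, ω.mult (startEdge j) = ω'.mult (startEdge j) +
          if (j : ℕ) = k then 1 else 0 := fun j => by
        have h1 := mult_startEdge_add ω j
        have h2 := mult_startEdge_add ω' j
        rw [hf] at h2
        omega
      have hspine : ∀ j, ω.mult (spineEdge j) + (if (j : ℕ) = k then 1 else 0) =
          ω'.mult (spineEdge j) + if (j : ℕ) = k + 1 then 1 else 0 := fun j => by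
        have h1 := mult_spineEdge_add ω j
        have h2 := mult_spineEdge_add ω' j
        simp only [hpad, Nat.add_right_cancel_iff] at h2
        omega
      refine ⟨fun e he => ?_, fun e he => ?_, fun e hodd heven => ?_⟩
      · rcases (isOddEdge_iff k e).1 he with rfl | rfl
        · simpa using hstart k
        · simpa using hspine k.succ
      · rcases (isEvenEdge_iff k e).1 he with rfl | rfl
        · simpa [profile] using hf k
        · simpa using (hspine k.castSucc).symm
      · rw [isOddEdge_iff, not_or] at hodd
        rw [isEvenEdge_iff, not_or] at heven
        rcases edge_cases e with ⟨j, rfl⟩ | ⟨j, rfl⟩ | ⟨j, rfl⟩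
        · have hj : (j : ℕ) ≠ k := fun hj => hodd.1 (by rw [Fin.ext hj])
          simpa [hj] using (hstart j).symm
        · have hj : (j : ℕ) ≠ k := fun hj => heven.1 (by rw [Fin.ext hj])
          simpa [profile, hj] using hf j
        · have hj : (j : ℕ) ≠ k := fun hj => heven.2 (by congr 1; exact Fin.ext hj)
          have hj' : (j : ℕ) ≠ k + 1 := fun hj => hodd.2 (by congr 1; exact Fin.ext hj)
          simpa [hj, hj'] using (hspine j).symm

end Twists

/-! ### The face twist order -/

section Order

variable {n : ℕ}

theorem profile_le_of_le {ω ω' : ZigzagCover n} (h : ω ≤ ω') : profile ω ≤ profile ω' := by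
  change ZigzagReach ω ω' at h
  induction h with
  | refl => exact le_rfl
  | tail _ h2 ih =>
    obtain ⟨k, hk⟩ := h2
    rw [(zigzagTwist_iff _ _ _).1 hk]
    exact ih.trans (le_add_of_nonneg_right (Pi.single_nonneg.2 zero_le_one))

theorem le_iff_profile_le {ω ω' : ZigzagCover n} : ω ≤ ω' ↔ profile ω ≤ profile ω' := by
  refine ⟨profile_le_of_le, fun h => ?_⟩
  induction hd : ∑ k, profile ω' k - ∑ k, profile ω k using Nat.strong_induction_on
    generalizing ω with
  | _ d ih =>
    by_cases heq : profile ω = profile ω'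
    · exact (profile_injective heq).le
    -- At the last place where the profiles differ, a positive twist is possible and stays
    -- below `ω'`.
    have hne : (Finset.univ.filter fun k => profile ω k < profile ω' k).Nonempty := by
      obtain ⟨k, hk⟩ := Function.ne_iff.1 heq
      exact ⟨k, by simpa using lt_of_le_of_ne (h k) hk⟩
    obtain ⟨k, hk, hmax⟩ := Finset.exists_max_image _ id hne
    simp only [Finset.mem_filter, Finset.mem_univ, true_and, id] at hk hmax
    have hle : profile ω + Pi.single k 1 ≤ profile ω' := by
      intro j
      by_cases hj : j = k
      · subst hj; simpa using hk
      · simpa [hj] using h j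
    have hmono : Monotone (profile ω + Pi.single k 1) := by
      intro i j hij
      by_cases hi : i = k
      · subst hi
        by_cases hj : j = i
        · rw [hj]
        · have h1 : ¬ profile ω j < profile ω' j := fun hlt => hj (le_antisymm (hmax j hlt) hij)
          have h2 := monotone_profile ω' hij
          simp only [Pi.add_apply, Pi.single_eq_same, Pi.single_eq_of_ne hj]
          omega
      · have h1 := monotone_profile ω hij
        simp only [Pi.add_apply, Pi.single_eq_of_ne hi]
        omega
    obtain ⟨ρ, hρ⟩ := exists_profile_eq hmono fun j => (hle j).trans (profile_le ω' j)
    have hsum : ∑ j, profile ρ j = ∑ j, profile ω j + 1 := by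
      simp [hρ, Finset.sum_add_distrib]
    have hsum' : ∑ j, profile ρ j ≤ ∑ j, profile ω' j :=
      Finset.sum_le_sum fun j _ => by rw [hρ]; exact hle j
    exact Relation.ReflTransGen.head ⟨k, (zigzagTwist_iff k ω ρ).2 hρ⟩
      (ih _ (by omega) (hρ ▸ hle) rfl)

theorem isBot_iff_profile_eq_zero {ω : ZigzagCover n} : IsBot ω ↔ profile ω = 0 := by
  constructor
  · intro h
    obtain ⟨ω₀, h₀⟩ := exists_profile_eq (n := n) (f := 0) monotone_const fun _ => Nat.zero_le _
    exact le_antisymm (h₀ ▸ profile_le_of_le (h ω₀)) fun _ => Nat.zero_le _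
  · intro h ω'
    rw [le_iff_profile_le, h]
    exact fun _ => Nat.zero_le _

theorem exists_isBot (n : ℕ) : ∃ ω₀ : ZigzagCover n, IsBot ω₀ :=
  (exists_profile_eq (n := n) (f := 0) monotone_const fun _ => Nat.zero_le _).imp
    fun _ => isBot_iff_profile_eq_zero.2

theorem ZigzagReachIn.sum_profile {r : ℕ} {ω ω' : ZigzagCover n} (h : ZigzagReachIn r ω ω') :
    ∑ k, profile ω' k = ∑ k, profile ω k + r := by
  obtain ⟨c, rfl, rfl, hc⟩ := h
  induction r with
  | zero => rfl
  | succ r ih =>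
    obtain ⟨k, hk⟩ := hc r r.lt_succ_self
    have := hk.sum_finalEdge
    have := ih fun i hi => hc i (hi.trans r.lt_succ_self)
    simp only [profile] at *
    omega

theorem ZigzagReach.exists_reachIn {ω ω' : ZigzagCover n} (h : ZigzagReach ω ω') :
    ∃ r, ZigzagReachIn r ω ω' := by
  induction h with
  | refl => exact ⟨0, fun _ => ω, rfl, rfl, by simp⟩
  | @tail ρ ρ' _ hstep ih =>
    obtain ⟨r, c, h0, hr, hc⟩ := ih
    refine ⟨r + 1, fun i => if i ≤ r then c i else ρ', by simpa using h0, by simp, fun i hi => ?_⟩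
    rcases Nat.lt_succ_iff_lt_or_eq.1 hi with hi | rfl
    · simpa [hi.le, Nat.succ_le_of_lt hi] using hc i hi
    · simpa [hr] using hstep

theorem zigzagRank_eq_sum_profile (ω : ZigzagCover n) : zigzagRank ω = ∑ k, profile ω k := by
  -- All ways to reach `ω` from the bottom have the same number of twists.
  have hset : {r | ∃ ω₀ : ZigzagCover n, IsBot ω₀ ∧ ZigzagReachIn r ω₀ ω} =
      {∑ k, profile ω k} := by
    have hsum : ∀ (r : ℕ) (ω₀ : ZigzagCover n), IsBot ω₀ → ZigzagReachIn r ω₀ ω →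
        r = ∑ k, profile ω k := fun r ω₀ h h' => by
      simp [h'.sum_profile, isBot_iff_profile_eq_zero.1 h]
    ext r
    refine ⟨fun ⟨ω₀, h, h'⟩ => hsum r ω₀ h h', ?_⟩
    rintro rfl
    obtain ⟨ω₀, h₀⟩ := exists_isBot n
    obtain ⟨r, hr⟩ := ZigzagReach.exists_reachIn (h₀ ω)
    exact ⟨ω₀, h₀, hsum r ω₀ h₀ hr ▸ hr⟩
  rw [zigzagRank, hset, csInf_singleton]

end Order

/-! ### The isomorphism -/

section Isomorphism

variable {n : ℕ}

/-- The profile of a cover, reversed and followed by a zero: the Lehmer code of the permutation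
that corresponds to the cover. -/
def coverCode (ω : ZigzagCover n) : Fin (n + 1) → ℕ :=
  Fin.snoc (α := fun _ => ℕ) (fun i => profile ω i.rev) 0

@[simp]
theorem coverCode_rev_castSucc (ω : ZigzagCover n) (k : Fin n) :
    coverCode ω k.rev.castSucc = profile ω k := by
  simp [coverCode]

@[simp]
theorem coverCode_last (ω : ZigzagCover n) : coverCode ω (Fin.last n) = 0 := by
  simp [coverCode]

theorem lehmerCode_last (σ : Equiv.Perm (Fin (n + 1))) : lehmerCode σ (Fin.last n) = 0 := by
  have := lehmerCode_add_lt σ (Fin.last n)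
  simp at this
  omega

/-- An index of a code is either `k.rev.castSucc` for a tile `k`, or the last one. -/
theorem forall_fin_iff_rev {P : Fin (n + 1) → Prop} :
    (∀ i, P i) ↔ (∀ k : Fin n, P k.rev.castSucc) ∧ P (Fin.last n) := by
  refine ⟨fun h => ⟨fun k => h _, h _⟩, fun h i => ?_⟩
  induction i using Fin.lastCases with
  | last => exact h.2
  | cast i => simpa using h.1 i.rev

theorem coverCode_le_iff {ω ω' : ZigzagCover n} :
    coverCode ω ≤ coverCode ω' ↔ profile ω ≤ profile ω' := by
  simp only [Pi.le_def]
  rw [forall_fin_iff_rev]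
  simp

theorem coverCode_eq_add_single_iff {ω ω' : ZigzagCover n} (k : Fin n) :
    coverCode ω' = coverCode ω + Pi.single k.rev.castSucc 1 ↔
      profile ω' = profile ω + Pi.single k 1 := by
  simp only [funext_iff]
  rw [forall_fin_iff_rev]
  simp [Pi.single_apply]

theorem sum_coverCode (ω : ZigzagCover n) : ∑ i, coverCode ω i = ∑ k, profile ω k := by
  rw [Fin.sum_univ_castSucc, coverCode_last, add_zero, ← Equiv.sum_comp Fin.revPerm]
  simp

theorem coverCode_injective : Function.Injective (coverCode (n := n)) := fun ω ω' h =>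
  profile_injective (funext fun k => by simpa using congrFun h k.rev.castSucc)

theorem antitone_coverCode (ω : ZigzagCover n) : Antitone (coverCode ω) := by
  intro i j hij
  induction j using Fin.lastCases with
  | last => simp
  | cast j =>
    induction i using Fin.lastCases with
    | last => exact absurd hij (not_le.2 (Fin.castSucc_lt_last j))
    | cast i =>
      simp only [coverCode, Fin.snoc_castSucc]
      exact monotone_profile ω (Fin.rev_le_rev.2 (Fin.castSucc_le_castSucc_iff.1 hij))

theorem exists_catPerm (ω : ZigzagCover n) :
    ∃ σ : CatPerm (n + 1), lehmerCode σ.perm = coverCode ω := by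
  obtain ⟨σ, hσ⟩ := exists_lehmerCode_eq (coverCode ω) <| forall_fin_iff_rev.2
    ⟨fun k => by have := profile_le ω k; simp; omega, by simp⟩
  exact ⟨⟨σ, avoids132_of_antitone (hσ ▸ antitone_coverCode ω)⟩, hσ⟩

theorem exists_coverCode_eq (σ : CatPerm (n + 1)) :
    ∃ ω : ZigzagCover n, coverCode ω = lehmerCode σ.perm := by
  obtain ⟨ω, hω⟩ := exists_profile_eq (f := fun k : Fin n => lehmerCode σ.perm k.rev.castSucc)
    (fun i j hij => σ.avoids.antitone_lehmerCode
      (Fin.castSucc_le_castSucc_iff.2 (Fin.rev_le_rev.2 hij)))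
    fun k => by
      have := lehmerCode_add_lt σ.perm k.rev.castSucc
      simp at this
      omega
  exact ⟨ω, funext (forall_fin_iff_rev.2 ⟨fun k => by simp [hω], by simp [lehmerCode_last]⟩)⟩

/-- The permutation whose Lehmer code is the code of the cover. -/
noncomputable def coverPerm (ω : ZigzagCover n) : CatPerm (n + 1) :=
  (exists_catPerm ω).choose

theorem lehmerCode_coverPerm (ω : ZigzagCover n) :
    lehmerCode (coverPerm ω).perm = coverCode ω :=
  (exists_catPerm ω).choose_spec

theorem coverPerm_bijective : Function.Bijective (coverPerm (n := n)) := by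
  constructor
  · intro ω ω' h
    exact coverCode_injective (by rw [← lehmerCode_coverPerm, h, lehmerCode_coverPerm])
  · intro σ
    obtain ⟨ω, hω⟩ := exists_coverCode_eq σ
    exact ⟨ω, CatPerm.ext (lehmerCode_injective ((lehmerCode_coverPerm ω).trans hω))⟩

theorem coverPerm_twist_iff (k : Fin n) (ω ω' : ZigzagCover n) :
    ZigzagTwist k ω ω' ↔ lehmerCode (coverPerm ω').perm =
      lehmerCode (coverPerm ω).perm + Pi.single k.rev.castSucc 1 := by
  rw [lehmerCode_coverPerm, lehmerCode_coverPerm, coverCode_eq_add_single_iff, zigzagTwist_iff]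

theorem coverPerm_le_iff {ω ω' : ZigzagCover n} : coverPerm ω ≤ coverPerm ω' ↔ ω ≤ ω' := by
  constructor
  · intro h
    have := BruhatLE.lehmerCode_le h (coverPerm ω).avoids
    rwa [lehmerCode_coverPerm, lehmerCode_coverPerm, coverCode_le_iff, ← le_iff_profile_le] at this
  · intro h
    change ZigzagReach ω ω' at h
    change BruhatLE (coverPerm ω).perm (coverPerm ω').perm
    induction h with
    | refl => exact Relation.ReflTransGen.refl
    | tail _ hstep ih =>
      obtain ⟨k, hk⟩ := hstep
      exact ih.tail (bruhatStep_of_lehmerCode_eq ((coverPerm_twist_iff k _ _).1 hk))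

theorem zigzagRank_eq_invCount (ω : ZigzagCover n) :
    zigzagRank ω = invCount (coverPerm ω).perm := by
  rw [zigzagRank_eq_sum_profile, ← sum_lehmerCode, lehmerCode_coverPerm, sum_coverCode]

theorem zigzagRankGenFun_eq_qCatalan (n : ℕ) : zigzagRankGenFun n = qCatalan (n + 1) := by
  refine Finset.sum_bij (fun ω _ => (coverPerm ω).perm) (fun ω _ => ?_) (fun ω _ ω' _ h => ?_)
    (fun σ hσ => ?_) fun ω _ => by rw [zigzagRank_eq_invCount]
  · simpa using (coverPerm ω).avoids
  · exact coverPerm_bijective.injective (CatPerm.ext h)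
  · obtain ⟨ω, hω⟩ := coverPerm_bijective.surjective ⟨σ, (Finset.mem_filter.1 hσ).2⟩
    exact ⟨ω, Finset.mem_univ _, by rw [hω]⟩

end Isomorphism

/-- Let `n` be the number of tiles of the zigzag snake. There is an isomorphism `φ` from the face
twist order to the Bruhat order on 132-avoiding permutations in `S_{n+1}`, namely the bijection for
which the Lehmer code of `φ ω`, without its last entry (which is always `0`), lists the
multiplicities in `ω` of the final edges of the tiles `n-1, …, 1, 0`. Positive twists at the `k`-th
tile correspond to incrementing the entry number `n-1-k` of the Lehmer code. The face twist order
has a least element, and its rank generating function is the `q`-Catalan number. -/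
theorem theorem8 (n : ℕ) :
    (∃ φ : ZigzagCover n ≃o CatPerm (n + 1),
      (∀ (ω : ZigzagCover n) (k : Fin n),
        lehmerCode (φ ω).perm k.rev.castSucc = ω.mult (finalEdge k)) ∧
      (∀ (k : Fin n) (ω ω' : ZigzagCover n),
        ZigzagTwist k ω ω' ↔
          lehmerCode (φ ω').perm = lehmerCode (φ ω).perm + Pi.single k.rev.castSucc 1)) ∧
    (∃ ω₀ : ZigzagCover n, IsBot ω₀) ∧
    zigzagRankGenFun n = qCatalan (n + 1) := by
  refine ⟨⟨⟨Equiv.ofBijective coverPerm coverPerm_bijective, coverPerm_le_iff⟩, fun ω k => ?_,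
    coverPerm_twist_iff⟩, exists_isBot n, zigzagRankGenFun_eq_qCatalan n⟩
  exact (congrFun (lehmerCode_coverPerm ω) _).trans (coverCode_rev_castSucc ω k)
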